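/- **Market model.** In round $t=1,\dots,T$ a feature $x_t\in[0,1]^d$ is drawn i.i.d. from a law $P_X$. The supply curve is $P_{St}(Q)=\alpha_0+\alpha_1Q+\epsilon_{St}$ and the demand curve is $P_{Dt}(Q,x_t)=\beta Q+f(x_t)+\epsilon_{Dt}$, with $\alpha_1\ge 0>\beta$. The $\epsilon_{St}$ are i.i.d., zero-mean and sub-Gaussian with variance $\sigma_S^2$; the $\epsilon_{Dt}$ are i.i.d., zero-mean and strongly log-concave with variance $\sigma_D^2$; features and noises are independent. The platform sees $x_t$ and the supply intercept $\alpha_0+\epsilon_{St}$ and chooses a fee $a_t$ as a (measurable, possibly randomized) function of these and of the past observations $(\alpha_0+\epsilon_{S\tau},x_\tau,P^e_\tau,Q^e_\tau)_{\tau<t}$. The buyer reports a demand curve $P'_{Dt}=P_{Dt}+\xi_t$, and the equilibrium $(P^e_t,Q^e_t)$ solves $P^e_t=P_{St}(Q^e_t)+a_t=P'_{Dt}(Q^e_t,x_t)$ (no truncation). The buyer is called myopic (discount rate $\gamma=0$) if each report maximizes the surplus of the current round, $\int_0^{Q^e_t}\big(P_{Dt}(Q,x_t)-P_{St}(Q)-a_t\big)\,dQ$.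 With $Q^e(P_S,P_D,a)$ the equilibrium quantity, and with $a_t^*$ the fee $a\ge 0$ that maximizes the expectation over $\epsilon_{Dt}$ of $a\,Q^e(P_{St},P_{Dt},a)$, the expected regret is $$\mathrm{Regret}(T)=\sum_{t=1}^T\mathbb E\big[a_t^*\,Q^e(P_{St},P_{Dt},a_t^*)-a_t\,Q^e(P_{St},P'_{Dt},a_t)\big]\in[-\infty,\infty].$$ **Theorem.** Suppose that the supply has no noise, i.e. $\sigma_S^2=0$. Fix $\alpha_1\ge0$, $B>0$, $\alpha_0<B$, $\underline\beta<\overline\beta<0$ and $0\le \underline v<\overline v$. There is a constant $c>0$, depending only on these seven numbers, such that the following holds for every $d$, every law $P_X$ on $[0,1]^d$, every class $\mathcal F$ of functions on $\mathbb R^d$ that contains the constants with values in $[-B,B]$, every $T\ge1$ and every algorithm (which may depend on all of the above, in particular on $T$): there is a market as above, with supply intercept $\alpha_0$, supply slope $\alpha_1$, feature law $P_X$, $\sigma_S^2=0$, $f\in\mathcal F$, $|f|\le B$, $\beta\in[\underline\beta,\overline\beta]$ and $\sigma_D^2\in[\underline v,\overline v]$, in which the expected regret of the algorithm against every myopic buyer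 satisfies $$\mathrm{Regret}(T)\ \ge\ c\,\sqrt T .$$ That is, the worst-case expected regret of any algorithm is $\Omega(\sqrt T)$. -/

import Mathlib

open MeasureTheory ProbabilityTheory

noncomputable section

namespace ServiceFee

/-- A law on `ℝ` is strongly log-concave: on a convex set it has a density `exp (-φ)`
with `φ` strongly convex, and it gives no mass to the complement of that set. -/
def StronglyLogConcave (ν : Measure ℝ) : Prop :=
  ∃ (S : Set ℝ) (κ : ℝ) (φ : ℝ → ℝ), Convex ℝ S ∧ 0 < κ ∧ StrongConvexOn S κ φ ∧
    ν = (volume.restrict S).withDensity (fun e => ENNReal.ofReal (Real.exp (-φ e)))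

/-- A market with supply curve `P = α₀ + α₁ Q + ε_S` and demand curve
`P = β Q + f x + ε_D`, where in every round the feature `x` and the two noises are drawn
independently from the three laws below. -/
structure Market (d : ℕ) where
  α₀ : ℝ
  α₁ : ℝ
  β : ℝ
  f : (Fin d → ℝ) → ℝ
  featureLaw : Measure (Fin d → ℝ)
  supplyNoise : Measure ℝ
  demandNoise : Measure ℝ
  α₁_nonneg : 0 ≤ α₁
  β_neg : β < 0
  measurable_f : Measurable f
  isProb_feature : IsProbabilityMeasure featureLaw
  isProb_supply : IsProbabilityMeasure supplyNoise
  isProb_demand : IsProbabilityMeasure demandNoise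
  feature_mem : ∀ᵐ x ∂featureLaw, x ∈ Set.Icc (0 : Fin d → ℝ) 1
  supply_mean : ∫ e, e ∂supplyNoise = 0
  supply_subGaussian : ∃ η : NNReal, HasSubgaussianMGF (fun e : ℝ => e) η supplyNoise
  demand_memLp : MemLp (fun e : ℝ => e) 2 demandNoise
  demand_mean : ∫ e, e ∂demandNoise = 0
  demand_logConcave : StronglyLogConcave demandNoise

/-- What the platform sees after a round: the intercept `α₀ + ε_S` of the supply curve,
the feature, the equilibrium price and the equilibrium quantity. -/
abbrev Obs (d : ℕ) : Type := ℝ × (Fin d → ℝ) × ℝ × ℝ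

/-- The primitive randomness of a round: the feature, `ε_S` and `ε_D`. -/
abbrev Shock (d : ℕ) : Type := (Fin d → ℝ) × ℝ × ℝ

/-- A possibly randomized algorithm of the platform. All its internal randomness is a seed,
drawn once and independently of the market; the fee of round `t` is a measurable function of
the seed, the observations of the earlier rounds, the current feature and the current supply
intercept. Fees of either sign are allowed. -/
structure Policy (d : ℕ) where
  Seed : Type*
  [instSeed : MeasurableSpace Seed]
  seedLaw : Measure Seed
  isProb_seed : IsProbabilityMeasure seedLaw
  fee : (t : ℕ) → Seed → (Fin t → Obs d) → (Fin d → ℝ) → ℝ → ℝ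
  measurable_fee : ∀ t, Measurable
    (fun p : Seed × (Fin t → Obs d) × (Fin d → ℝ) × ℝ => fee t p.1 p.2.1 p.2.2.1 p.2.2.2)

attribute [instance] Policy.instSeed

/-- A reporting rule of the buyer: in round `t`, knowing the past observations, the feature,
the supply intercept, the fee and the own noise `ε_D` (in this order), the buyer shifts the
demand curve by the returned number `ξ`, that is, reports `P = β Q + f x + ε_D + ξ`. -/
abbrev Buyer (d : ℕ) : Type :=
  (t : ℕ) → (Fin t → Obs d) → (Fin d → ℝ) → ℝ → ℝ → ℝ → ℝ

/-- Expectation, with values in the extended reals, of a real random variable. It is `⊥` when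
both the positive and the negative part have infinite expectation. -/
def extExpect {Ω : Type*} [MeasurableSpace Ω] (μ : Measure Ω) (g : Ω → ℝ) : EReal :=
  ((∫⁻ w, ENNReal.ofReal (g w) ∂μ : ENNReal) : EReal) -
    ((∫⁻ w, ENNReal.ofReal (-g w) ∂μ : ENNReal) : EReal)

namespace Market

variable {d : ℕ} (M : Market d)

/-- The equilibrium quantity with supply intercept `s`, feature `x`, fee `a`, demand noise `e`
and reported shift `ξ`. -/
def quantity (s : ℝ) (x : Fin d → ℝ) (a e ξ : ℝ) : ℝ :=
  (M.f x + e + ξ - s - a) / (M.α₁ - M.β)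

/-- The equilibrium price (paid by the buyer, fee included). -/
def price (s : ℝ) (x : Fin d → ℝ) (a e ξ : ℝ) : ℝ :=
  s + M.α₁ * M.quantity s x a e ξ + a

/-- `quantity` is the solution of `P_S(Q) + a = P'_D(Q, x)`. -/
theorem equilibrium (s : ℝ) (x : Fin d → ℝ) (a e ξ q : ℝ) :
    s + M.α₁ * q + a = M.β * q + M.f x + e + ξ ↔ q = M.quantity s x a e ξ := by
  have h : M.α₁ - M.β ≠ 0 := by have := M.α₁_nonneg; have := M.β_neg; linarith
  unfold quantity
  rw [eq_div_iff h]
  constructor <;> intro h' <;> linarith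

/-- The buyer's surplus in a round in which the quantity `q` is traded:
`∫₀^q (P_D(Q, x) - P_S(Q) - a) dQ` with the true demand curve. -/
def surplus (s : ℝ) (x : Fin d → ℝ) (a e q : ℝ) : ℝ :=
  ∫ y in (0 : ℝ)..q, ((M.β * y + M.f x + e) - (s + M.α₁ * y) - a)

/-- A myopic buyer, that is, one with discount rate `0`: the discounted sum of the current and
future surpluses is the surplus of the current round, and every report maximizes it. -/
def IsMyopic (b : Buyer d) : Prop :=
  ∀ (t : ℕ) (h : Fin t → Obs d) (x : Fin d → ℝ) (s a e ξ : ℝ),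
    M.surplus s x a e (M.quantity s x a e ξ) ≤
      M.surplus s x a e (M.quantity s x a e (b t h x s a e))

theorem surplus_eq (s : ℝ) (x : Fin d → ℝ) (a e q : ℝ) :
    M.surplus s x a e q = (M.f x + e - s - a) * q - (M.α₁ - M.β) / 2 * q ^ 2 := by
  unfold surplus
  have : ∀ y : ℝ, (M.β * y + M.f x + e) - (s + M.α₁ * y) - a
      = (M.f x + e - s - a) - (M.α₁ - M.β) * y := fun y => by ring
  simp only [this]
  rw [intervalIntegral.integral_sub (by simp) (by apply Continuous.intervalIntegrable; fun_prop),
    intervalIntegral.integral_const_mul, integral_id, intervalIntegral.integral_const, smul_eq_mul]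
  ring

/-- Myopic buyers are exactly the truthful ones; in particular they exist. -/
theorem isMyopic_iff (b : Buyer d) :
    M.IsMyopic b ↔ ∀ t h x s a e, b t h x s a e = 0 := by
  have hm : 0 < M.α₁ - M.β := by have := M.α₁_nonneg; have := M.β_neg; linarith
  have key : ∀ s x a e ξ, M.surplus s x a e (M.quantity s x a e ξ)
      = ((M.f x + e - s - a) ^ 2 - ξ ^ 2) / (2 * (M.α₁ - M.β)) := by
    intro s x a e ξ
    rw [surplus_eq]; unfold quantity
    field_simp
    ring
  constructor
  · intro h t hh x s a e
    have h1 := h t hh x s a e 0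
    rw [key, key, div_le_div_iff_of_pos_right (by positivity)] at h1
    have : (b t hh x s a e) ^ 2 ≤ 0 := by linarith
    exact pow_eq_zero_iff (two_ne_zero) |>.1 (le_antisymm this (sq_nonneg _))
  · intro h t hh x s a e ξ
    rw [h, key, key, div_le_div_iff_of_pos_right (by positivity)]
    nlinarith [sq_nonneg ξ]

/-- `a` is an optimal fee of the clairvoyant platform facing truthful demand: among
nonnegative fees it maximizes the expected revenue, over the demand noise, given the feature
and the supply curve. -/
def IsOptFee (s : ℝ) (x : Fin d → ℝ) (a : ℝ) : Prop :=
  0 ≤ a ∧ ∀ a', 0 ≤ a' →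
    ∫ e, a' * M.quantity s x a' e 0 ∂M.demandNoise ≤ ∫ e, a * M.quantity s x a e 0 ∂M.demandNoise

/-- The optimal fee. -/
def optFee (s : ℝ) (x : Fin d → ℝ) : ℝ := Classical.epsilon (M.IsOptFee s x)

theorem expRevenue_eq (s : ℝ) (x : Fin d → ℝ) (a : ℝ) :
    ∫ e, a * M.quantity s x a e 0 ∂M.demandNoise = a * (M.f x - s - a) / (M.α₁ - M.β) := by
  have := M.isProb_demand
  have hi : Integrable (fun e : ℝ => e) M.demandNoise := M.demand_memLp.integrable (by norm_num)
  have : ∀ e : ℝ, a * M.quantity s x a e 0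
      = a * (M.f x - s - a) / (M.α₁ - M.β) + a / (M.α₁ - M.β) * e := by
    intro e; unfold quantity; ring
  simp only [this]
  rw [integral_add (integrable_const _) (hi.const_mul _), integral_const_mul, M.demand_mean]
  simp

/-- The optimal fee exists and is unique. -/
theorem isOptFee_iff (s : ℝ) (x : Fin d → ℝ) (a : ℝ) :
    M.IsOptFee s x a ↔ a = max 0 ((M.f x - s) / 2) := by
  have hm : 0 < M.α₁ - M.β := by have := M.α₁_nonneg; have := M.β_neg; linarith
  unfold IsOptFee
  simp only [expRevenue_eq, div_le_div_iff_of_pos_right hm]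
  constructor
  · rintro ⟨h0, h⟩
    have h1 := h _ (le_max_left 0 ((M.f x - s) / 2))
    rcases le_total 0 ((M.f x - s) / 2) with h2 | h2
    · rw [max_eq_right h2] at h1 ⊢
      have : (a - (M.f x - s) / 2) ^ 2 ≤ 0 := by nlinarith
      have := pow_eq_zero_iff (two_ne_zero) |>.1 (le_antisymm this (sq_nonneg _))
      linarith
    · rw [max_eq_left h2] at h1 ⊢
      nlinarith
  · rintro rfl
    refine ⟨le_max_left _ _, fun a' ha' => ?_⟩
    rcases le_total 0 ((M.f x - s) / 2) with h2 | h2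
    · rw [max_eq_right h2]; nlinarith [sq_nonneg (a' - (M.f x - s) / 2)]
    · rw [max_eq_left h2]; nlinarith

theorem optFee_eq (s : ℝ) (x : Fin d → ℝ) : M.optFee s x = max 0 ((M.f x - s) / 2) :=
  (M.isOptFee_iff s x _).1 (Classical.epsilon_spec ⟨_, (M.isOptFee_iff s x _).2 rfl⟩)

/-- The observations of the first `t` rounds when `π` plays against `b`, as a function of the
seed and of the sequence of shocks. -/
def history (π : Policy d) (b : Buyer d) (u : π.Seed) (z : ℕ → Shock d) :
    (t : ℕ) → Fin t → Obs d
  | 0 => Fin.elim0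
  | t + 1 =>
    let h := history π b u z t
    let x := (z t).1
    let s := M.α₀ + (z t).2.1
    let e := (z t).2.2
    let a := π.fee t u h x s
    let ξ := b t h x s a e
    Fin.snoc (α := fun _ => Obs d) h (s, x, M.price s x a e ξ, M.quantity s x a e ξ)

/-- The revenue loss of round `t`:
`a_t^* Q(P_S, P_D, a_t^*) - a_t Q(P_S, P'_D, a_t)`. -/
def roundLoss (π : Policy d) (b : Buyer d) (t : ℕ) (w : π.Seed × (ℕ → Shock d)) : ℝ :=
  let h := M.history π b w.1 w.2 t
  let x := (w.2 t).1
  let s := M.α₀ + (w.2 t).2.1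
  let e := (w.2 t).2.2
  let a := π.fee t w.1 h x s
  let ξ := b t h x s a e
  M.optFee s x * M.quantity s x (M.optFee s x) e 0 - a * M.quantity s x a e ξ

/-- The joint law of the shocks of one round. -/
def shockLaw : Measure (Shock d) := M.featureLaw.prod (M.supplyNoise.prod M.demandNoise)

/-- The joint law of the seed and of the i.i.d. sequence of shocks. -/
def law (π : Policy d) : Measure (π.Seed × (ℕ → Shock d)) :=
  π.seedLaw.prod (Measure.infinitePi (fun _ : ℕ => M.shockLaw))

/-- The expected regret of `π` over `T` rounds against the buyer `b`. -/
def regret (π : Policy d) (b : Buyer d) (T : ℕ) : EReal :=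
  ∑ t ∈ Finset.range T, extExpect (M.law π) (M.roundLoss π b t)

end Market

end ServiceFee

end

/-!
A rotation of the demand curve about the clairvoyant's expected trade leaves the mean of the traded
quantity unchanged at the clairvoyant's fee `a`. Rotate by an angle of order `θ`, and rescale the
Gaussian demand noise so that the variance of the quantity does not change either. Then a round
with fee `p` tells the two markets apart only by a divergence of order `θ² (p - a)²`, while its
regret is of order `(p - a)²`: an algorithm learns `θ` only by paying for it. By the chain rule
the divergence between the two laws of the past is at most of order `θ²` times the regret.

The two optimal fees differ by a multiple of `θ`, so by Le Cam's two-point method every round costs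
of order `θ²` in one of the two markets, up to `θ²` times that divergence. Over `T` rounds this
reads `T θ² ≲ (1 + T θ⁴) · Regret`, and `θ` of order `T ^ (-1/4)` gives a regret of order `√T`.
-/

namespace ServiceFee

open InformationTheory
open scoped ENNReal NNReal

section Divergence

variable {α β : Type*} [MeasurableSpace α] [MeasurableSpace β]

theorem half_le_min_one_add_klFun {x : ℝ} (hx : 0 ≤ x) : 1 / 2 ≤ min x 1 + klFun x := by
  rcases le_total x 1 with h | h
  · rcases hx.eq_or_lt with rfl | hx
    · norm_num [klFun_zero]
    have hlog : 1 - (2 * x)⁻¹ ≤ Real.log 2 + Real.log x := by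
      rw [← Real.log_mul two_ne_zero hx.ne']
      exact Real.one_sub_inv_le_log_of_pos (by positivity)
    have hmul : x * (1 - (2 * x)⁻¹) = x - 1 / 2 := by field_simp
    rw [min_eq_left h, klFun_apply]
    nlinarith [mul_le_mul_of_nonneg_left hlog hx.le, mul_pos hx (sub_pos.2 Real.log_two_lt_d9)]
  · linarith [min_eq_right h, klFun_nonneg hx]

theorem half_le_lintegral_add_lintegral_add_klDiv (μ ν : Measure α) [IsFiniteMeasure μ]
    [IsProbabilityMeasure ν] {f g : α → ℝ≥0∞} (hf : Measurable f)
    {c : ℝ≥0∞} (hc : ∀ x, c ≤ f x + g x) :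
    c / 2 ≤ ∫⁻ x, f x ∂μ + ∫⁻ x, g x ∂ν + c * klDiv μ ν := by
  rcases eq_or_ne c 0 with rfl | hc0
  · simp
  by_cases hac : μ ≪ ν
  swap
  · simp [klDiv_of_not_ac hac, ENNReal.mul_top hc0]
  have hpoint : ∀ᵐ x ∂ν, c / 2 ≤ μ.rnDeriv ν x * f x + g x
      + c * ENNReal.ofReal (klFun (μ.rnDeriv ν x).toReal) := by
    filter_upwards [μ.rnDeriv_lt_top ν] with x hx
    set p := μ.rnDeriv ν x
    have hhalf : 1 / 2 ≤ min p 1 + ENNReal.ofReal (klFun p.toReal) := by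
      have h := ENNReal.ofReal_le_ofReal
        (half_le_min_one_add_klFun (ENNReal.toReal_nonneg (a := p)))
      rw [ENNReal.ofReal_add (by positivity) (klFun_nonneg ENNReal.toReal_nonneg),
        (ENNReal.ofReal_mono).map_min, ENNReal.ofReal_toReal hx.ne] at h
      simpa using h
    calc c / 2 = c * (1 / 2) := by rw [mul_one_div]
      _ ≤ c * (min p 1 + ENNReal.ofReal (klFun p.toReal)) := by gcongr
      _ = min p 1 * c + c * ENNReal.ofReal (klFun p.toReal) := by rw [mul_add, mul_comm c]
      _ ≤ min p 1 * (f x + g x) + c * ENNReal.ofReal (klFun p.toReal) := by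
        gcongr; exact hc x
      _ ≤ p * f x + g x + c * ENNReal.ofReal (klFun p.toReal) := by
        rw [mul_add]
        gcongr
        · exact min_le_left _ _
        · exact mul_le_of_le_one_left' (min_le_right _ _)
  calc c / 2 = ∫⁻ _, c / 2 ∂ν := by simp
    _ ≤ _ := lintegral_mono_ae hpoint
    _ = _ := by
      rw [lintegral_add_right _ (by fun_prop), lintegral_const_mul _ (by fun_prop),
        lintegral_add_left (by fun_prop), lintegral_rnDeriv_mul hac hf.aemeasurable,
        klDiv_eq_lintegral_klFun_of_ac hac]

theorem klDiv_prod_left (μ ν : Measure α) [IsFiniteMeasure μ] [IsFiniteMeasure ν]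
    (ρ : Measure β) [IsProbabilityMeasure ρ] : klDiv (μ.prod ρ) (ν.prod ρ) = klDiv μ ν := by
  rw [← Measure.compProd_const, ← Measure.compProd_const, klDiv_compProd_left]

theorem klDiv_compProd_right [MeasurableSpace.CountableOrCountablyGenerated α β] (μ : Measure α)
    [IsFiniteMeasure μ] (κ η : Kernel α β) [IsFiniteKernel κ] [IsFiniteKernel η]
    (h : ∀ x, κ x ≪ η x) :
    klDiv (μ ⊗ₘ κ) (μ ⊗ₘ η) = ∫⁻ x, klDiv (κ x) (η x) ∂μ := by
  have hκ : η.withDensity (κ.rnDeriv η) = κ := by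
    ext1 x
    exact Kernel.withDensity_rnDeriv_eq (h x)
  have hmeas : Measurable fun p : α × β => κ.rnDeriv η p.1 p.2 := κ.measurable_rnDeriv η
  have hdens : μ ⊗ₘ κ = (μ ⊗ₘ η).withDensity fun p => κ.rnDeriv η p.1 p.2 := by
    have : IsFiniteKernel (η.withDensity (κ.rnDeriv η)) := hκ.symm ▸ ‹IsFiniteKernel κ›
    conv_lhs => rw [← hκ]
    exact Measure.compProd_withDensity hmeas
  have hrn : (μ ⊗ₘ κ).rnDeriv (μ ⊗ₘ η) =ᵐ[μ ⊗ₘ η] fun p => κ.rnDeriv η p.1 p.2 := by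
    rw [hdens]
    exact Measure.rnDeriv_withDensity _ hmeas
  rw [klDiv_eq_lintegral_klFun_of_ac (hdens ▸ withDensity_absolutelyContinuous _ _),
    lintegral_congr_ae (hrn.mono fun p hp => by rw [hp]),
    Measure.lintegral_compProd (by fun_prop)]
  refine lintegral_congr fun x => ?_
  rw [klDiv_eq_lintegral_klFun_of_ac (h x)]
  exact lintegral_congr_ae ((Kernel.rnDeriv_eq_rnDeriv_measure (κ := κ)).mono fun y hy => by
    simp only [hy])

end Divergence

section Gaussian

variable {v : ℝ≥0}

theorem gaussianReal_eq_withDensity_exp (a b : ℝ) (hv : v ≠ 0) :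
    gaussianReal a v = (gaussianReal b v).withDensity
      fun q => ENNReal.ofReal (Real.exp ((a - b) / v * q - (a ^ 2 - b ^ 2) / (2 * v))) := by
  have hv' : (v : ℝ) ≠ 0 := NNReal.coe_ne_zero.2 hv
  rw [gaussianReal_of_var_ne_zero _ hv, gaussianReal_of_var_ne_zero _ hv,
    ← withDensity_mul _ (by fun_prop) (by fun_prop)]
  congr 1 with q
  rw [Pi.mul_apply, gaussianPDF, gaussianPDF, ← ENNReal.ofReal_mul (gaussianPDFReal_nonneg _ _ _),
    gaussianPDFReal, gaussianPDFReal, mul_assoc _ (Real.exp _), ← Real.exp_add]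
  congr 3
  field_simp
  ring

theorem klDiv_gaussianReal (a b : ℝ) (hv : v ≠ 0) :
    klDiv (gaussianReal a v) (gaussianReal b v) = ENNReal.ofReal ((a - b) ^ 2 / (2 * v)) := by
  have hac := (gaussianReal_absolutelyContinuous a hv).trans
    (gaussianReal_absolutelyContinuous' b hv)
  have hllr : llr (gaussianReal a v) (gaussianReal b v) =ᵐ[gaussianReal a v]
      fun q => (a - b) / v * q - (a ^ 2 - b ^ 2) / (2 * v) := by
    have h := Measure.rnDeriv_withDensity (gaussianReal b v) (f := fun q => ENNReal.ofReal
      (Real.exp ((a - b) / v * q - (a ^ 2 - b ^ 2) / (2 * v)))) (by fun_prop)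
    rw [← gaussianReal_eq_withDensity_exp a b hv] at h
    filter_upwards [hac.ae_le h] with q hq
    rw [llr, hq, ENNReal.toReal_ofReal (Real.exp_nonneg _), Real.log_exp]
  have hlin : Integrable (fun q : ℝ => (a - b) / v * q) (gaussianReal a v) :=
    ((memLp_id_gaussianReal 1).integrable le_rfl).const_mul _
  rw [klDiv_of_ac_of_integrable hac ((integrable_congr hllr).2 (hlin.sub (integrable_const _))),
    integral_congr_ae hllr, integral_sub hlin (integrable_const _), integral_const_mul,
    integral_id_gaussianReal]
  congr 1
  simp only [integral_const, probReal_univ, one_smul, add_sub_cancel_right]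
  have hv' : (v : ℝ) ≠ 0 := NNReal.coe_ne_zero.2 hv
  field_simp
  ring

theorem stronglyLogConcave_gaussianReal (hv : v ≠ 0) :
    StronglyLogConcave (gaussianReal 0 v) := by
  refine ⟨Set.univ, 1 / v, fun e => e ^ 2 / (2 * v) + Real.log (Real.sqrt (2 * Real.pi * v)),
    convex_univ, by positivity, ?_, ?_⟩
  · refine strongConvexOn_iff_convex.2 ((convexOn_const (Real.log (Real.sqrt (2 * Real.pi * v)))
      convex_univ).congr fun x _ => ?_)
    rw [Real.norm_eq_abs, sq_abs]
    ring
  · rw [Measure.restrict_univ, gaussianReal_of_var_ne_zero _ hv]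
    congr with e
    rw [gaussianPDF, gaussianPDFReal, neg_add, Real.exp_add, Real.exp_neg (Real.log _),
      Real.exp_log (by positivity), mul_comm, sub_zero, neg_div]

end Gaussian

section ExtExpect

variable {α β : Type*} [MeasurableSpace α] [MeasurableSpace β]

theorem extExpect_map (μ : Measure α) {φ : α → β} (hφ : Measurable φ) {g : β → ℝ}
    (hg : Measurable g) : extExpect (μ.map φ) g = extExpect μ (g ∘ φ) := by
  rw [extExpect, lintegral_map (by fun_prop) hφ, lintegral_map (by fun_prop) hφ]
  rfl

theorem lintegral_ofReal_eq_add_of_integral_nonneg {μ : Measure α} {g : α → ℝ}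
    (hg : Integrable g μ) (h : 0 ≤ ∫ x, g x ∂μ) :
    ∫⁻ x, ENNReal.ofReal (g x) ∂μ
      = ENNReal.ofReal (∫ x, g x ∂μ) + ∫⁻ x, ENNReal.ofReal (-g x) ∂μ := by
  have hneg : ∫⁻ x, ENNReal.ofReal (-g x) ∂μ ≠ ∞ := hg.neg.lintegral_lt_top.ne
  rw [← ENNReal.toReal_eq_toReal_iff' hg.lintegral_lt_top.ne (by finiteness),
    ENNReal.toReal_add (by finiteness) hneg, ENNReal.toReal_ofReal h,
    integral_eq_lintegral_pos_part_sub_lintegral_neg_part hg, sub_add_cancel]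

theorem extExpect_prod (μ : Measure α) (ρ : Measure β) [SFinite μ] [SFinite ρ] {g : α × β → ℝ}
    (hg : Measurable g) (hg_int : ∀ᵐ y ∂μ, Integrable (fun e => g (y, e)) ρ)
    (hnonneg : ∀ᵐ y ∂μ, 0 ≤ ∫ e, g (y, e) ∂ρ)
    (hneg : ∫⁻ y, ∫⁻ e, ENNReal.ofReal (-g (y, e)) ∂ρ ∂μ ≠ ∞) :
    extExpect (μ.prod ρ) g
      = ((∫⁻ y, ENNReal.ofReal (∫ e, g (y, e) ∂ρ) ∂μ : ℝ≥0∞) : EReal) := by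
  have hsplit : ∫⁻ y, ∫⁻ e, ENNReal.ofReal (g (y, e)) ∂ρ ∂μ
      = ∫⁻ y, ENNReal.ofReal (∫ e, g (y, e) ∂ρ) ∂μ
        + ∫⁻ y, ∫⁻ e, ENNReal.ofReal (-g (y, e)) ∂ρ ∂μ := by
    rw [← lintegral_add_right _ (by fun_prop)]
    refine lintegral_congr_ae ?_
    filter_upwards [hg_int, hnonneg] with y hy hy0
    exact lintegral_ofReal_eq_add_of_integral_nonneg hy hy0
  rw [extExpect, lintegral_prod _ (by fun_prop), lintegral_prod _ (by fun_prop), hsplit]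
  lift ∫⁻ y, ∫⁻ e, ENNReal.ofReal (-g (y, e)) ∂ρ ∂μ to ℝ≥0 using hneg with c
  rw [EReal.coe_ennreal_add]
  exact EReal.add_sub_cancel_right

end ExtExpect

section Pushforward

variable {α β γ : Type*} [MeasurableSpace α] [MeasurableSpace β] [MeasurableSpace γ]

/-- The kernel sending `y` to the law of `φ (y, e)` for a noise `e` with law `ρ`. -/
noncomputable def noiseKernel {φ : α × β → γ} (hφ : Measurable φ) (ρ : Measure β) [SFinite ρ] :
    Kernel α γ where
  toFun y := ρ.map fun e => φ (y, e)
  measurable' := by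
    have h := (Measure.measurable_map φ hφ).comp (Measurable.map_prodMk_left (ν := ρ))
    simpa only [Function.comp_def, Measure.map_map hφ measurable_prodMk_left] using h

variable {φ : α × β → γ} (hφ : Measurable φ)

theorem noiseKernel_apply (ρ : Measure β) [SFinite ρ] (y : α) :
    noiseKernel hφ ρ y = ρ.map fun e => φ (y, e) := rfl

instance (ρ : Measure β) [IsProbabilityMeasure ρ] : IsMarkovKernel (noiseKernel hφ ρ) :=
  ⟨fun _ => Measure.isProbabilityMeasure_map (by fun_prop)⟩

theorem compProd_noiseKernel (μ : Measure α) [SFinite μ] (ρ : Measure β)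
    [IsProbabilityMeasure ρ] :
    μ ⊗ₘ noiseKernel hφ ρ = (μ.prod ρ).map fun p => (p.1, φ p) := by
  refine Measure.ext_of_lintegral _ fun F hF => ?_
  rw [Measure.lintegral_compProd hF, lintegral_map hF (by fun_prop),
    lintegral_prod _ (by fun_prop)]
  refine lintegral_congr fun y => ?_
  rw [noiseKernel_apply, lintegral_map (by fun_prop) (by fun_prop)]

theorem indepFun_prodMk_fst_of_indepFun (μ : Measure α) [IsProbabilityMeasure μ] {Ω : Type*}
    [MeasurableSpace Ω] {P : Measure Ω} [IsProbabilityMeasure P] {X : Ω → β} {Y : Ω → γ}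
    (hX : Measurable X) (hY : Measurable Y) (h : IndepFun X Y P) :
    IndepFun (fun w : α × Ω => (w.1, X w.2)) (fun w => Y w.2) (μ.prod P) := by
  have hmapX : (μ.prod P).map (fun w => (w.1, X w.2)) = μ.prod (P.map X) := by
    simpa [Prod.map_def] using (Measure.map_prod_map μ P measurable_id hX).symm
  have hmapXY : (μ.prod P).map (fun w => (w.1, X w.2, Y w.2))
      = μ.prod (P.map fun w => (X w, Y w)) := by
    simpa [Prod.map_def] using (Measure.map_prod_map μ P measurable_id (hX.prodMk hY)).symm
  have hmapY : (μ.prod P).map (fun w => Y w.2) = P.map Y := by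
    simpa [Function.comp_def] using (Measure.map_map hY (measurable_snd (α := α))
      (μ := μ.prod P)).symm
  rw [indepFun_iff_map_prod_eq_prod_map_map (by fun_prop) (by fun_prop), hmapX, hmapY]
  apply MeasurableEquiv.prodAssoc.map_measurableEquiv_injective
  rw [Measure.prodAssoc_prod, ← h.map_prod_eq_prod_map_map hX.aemeasurable hY.aemeasurable,
    ← hmapXY, Measure.map_map (by fun_prop) (by fun_prop)]
  rfl

end Pushforward

instance {d : ℕ} (M : Market d) : IsProbabilityMeasure M.featureLaw := M.isProb_feature
instance {d : ℕ} (M : Market d) : IsProbabilityMeasure M.supplyNoise := M.isProb_supply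
instance {d : ℕ} (M : Market d) : IsProbabilityMeasure M.demandNoise := M.isProb_demand
instance {d : ℕ} (π : Policy d) : IsProbabilityMeasure π.seedLaw := π.isProb_seed
instance {d : ℕ} (M : Market d) : IsProbabilityMeasure M.shockLaw := by
  unfold Market.shockLaw; infer_instance
instance {d : ℕ} (M : Market d) (π : Policy d) : IsProbabilityMeasure (M.law π) := by
  unfold Market.law; infer_instance

/-- The buyer who reports the true demand curve. -/
def truthful (d : ℕ) : Buyer d := fun _ _ _ _ _ _ => 0

@[fun_prop]
theorem measurable_finSnoc {α X : Type*} [MeasurableSpace α] [MeasurableSpace X] {n : ℕ}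
    {f : α → Fin n → X} {g : α → X} (hf : Measurable f) (hg : Measurable g) :
    Measurable fun x => (Fin.snoc (α := fun _ => X) (f x) (g x) : Fin (n + 1) → X) := by
  refine measurable_pi_iff.2 fun i => ?_
  induction i using Fin.lastCases with
  | last => simpa only [Fin.snoc_last] using hg
  | cast j => simpa only [Fin.snoc_castSucc] using measurable_pi_iff.1 hf j

namespace Policy

variable {d : ℕ} (π : Policy d) (t : ℕ)

/-- The seed and the observations of the first `t` rounds. -/
abbrev Past : Type _ := π.Seed × (Fin t → Obs d)

/-- What the platform knows when it sets the fee of round `t`: the past, the feature and the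
supply intercept. -/
abbrev Info : Type _ := π.Past t × (Fin d → ℝ) × ℝ

variable {t}

/-- The fee of round `t` as a function of what the platform knows. -/
def feeAt (y : π.Info t) : ℝ := π.fee t y.1.1 y.1.2 y.2.1 y.2.2

@[fun_prop]
theorem measurable_feeAt : Measurable (π.feeAt : π.Info t → ℝ) :=
  (π.measurable_fee t).comp (by fun_prop : Measurable fun y : π.Info t =>
    (y.1.1, y.1.2, y.2.1, y.2.2))

/-- The past of round `t + 1`, computed from what the platform knows in round `t` and from the
quantity `q` traded in it, when the supply slope is `α₁`. -/
def extendPast (α₁ : ℝ) (p : π.Info t × ℝ) : π.Past (t + 1) :=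
  (p.1.1.1, Fin.snoc (α := fun _ => Obs d) p.1.1.2
    (p.1.2.2, p.1.2.1, p.1.2.2 + α₁ * p.2 + π.feeAt p.1, p.2))

@[fun_prop]
theorem measurable_extendPast (α₁ : ℝ) :
    Measurable (π.extendPast α₁ : π.Info t × ℝ → π.Past (t + 1)) := by
  unfold extendPast; fun_prop

end Policy

namespace Market

variable {d : ℕ} (M : Market d) (π : Policy d) (t : ℕ)

theorem eq_truthful_of_isMyopic {b : Buyer d} (h : M.IsMyopic b) : b = truthful d := by
  funext t hh x s a e
  exact (M.isMyopic_iff b).1 h t hh x s a e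

theorem slope_pos : 0 < M.α₁ - M.β := by linarith [M.α₁_nonneg, M.β_neg]

@[fun_prop]
theorem measurable_quantity {α : Type*} [MeasurableSpace α] {s a e ξ : α → ℝ}
    {x : α → Fin d → ℝ} (hs : Measurable s) (hx : Measurable x) (ha : Measurable a)
    (he : Measurable e) (hξ : Measurable ξ) :
    Measurable fun i => M.quantity (s i) (x i) (a i) (e i) (ξ i) := by
  have := M.measurable_f
  unfold quantity; fun_prop

/-- The quantity traded in round `t` against the truthful buyer as a function of what the platform
knows and of the demand noise. -/
noncomputable def quantityAt {t : ℕ} (p : π.Info t × ℝ) : ℝ :=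
  M.quantity p.1.2.2 p.1.2.1 (π.feeAt p.1) p.2 0

@[fun_prop]
theorem measurable_quantityAt : Measurable (M.quantityAt π : π.Info t × ℝ → ℝ) := by
  unfold quantityAt; fun_prop

/-- The past of round `t` against the truthful buyer. -/
noncomputable def past (w : π.Seed × (ℕ → Shock d)) : π.Past t :=
  (w.1, M.history π (truthful d) w.1 w.2 t)

/-- What the platform knows in round `t` against the truthful buyer. -/
noncomputable def info (w : π.Seed × (ℕ → Shock d)) : π.Info t :=
  (M.past π t w, (w.2 t).1, M.α₀ + (w.2 t).2.1)

variable {t} in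
theorem past_succ (w : π.Seed × (ℕ → Shock d)) :
    M.past π (t + 1) w = π.extendPast M.α₁
      (M.info π t w, M.quantityAt π (M.info π t w, (w.2 t).2.2)) := rfl

@[fun_prop]
theorem measurable_past : Measurable (M.past π t) := by
  induction t with
  | zero => exact measurable_fst.prodMk measurable_const
  | succ t ih =>
    have hinfo : Measurable (M.info π t) := by unfold info; fun_prop
    simp only [funext (M.past_succ π)]
    fun_prop

@[fun_prop]
theorem measurable_info : Measurable (M.info π t) := by unfold info; fun_prop

variable {t} in
theorem history_congr (b : Buyer d) (u : π.Seed) {z z' : ℕ → Shock d}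
    (h : ∀ i < t, z i = z' i) : M.history π b u z t = M.history π b u z' t := by
  induction t with
  | zero => rfl
  | succ t ih => simp only [history, ih fun i hi => h i (by omega), h t (by omega)]

/-- The law of the supply intercept of a round. -/
noncomputable def interceptLaw : Measure ℝ := M.supplyNoise.map (M.α₀ + ·)

instance : IsProbabilityMeasure M.interceptLaw :=
  Measure.isProbabilityMeasure_map (by fun_prop)

/-- The law of the past of round `t` against the truthful buyer. -/
noncomputable def pastLaw : Measure (π.Past t) := (M.law π).map (M.past π t)

instance : IsProbabilityMeasure (M.pastLaw π t) := Measure.isProbabilityMeasure_map (by fun_prop)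

/-- The law of what the platform knows in round `t` against the truthful buyer. -/
noncomputable def infoLaw : Measure (π.Info t) :=
  (M.pastLaw π t).prod (M.featureLaw.prod M.interceptLaw)

instance : IsProbabilityMeasure (M.infoLaw π t) := by unfold infoLaw; infer_instance

/-- The expected squared distance to `a` of the fee of round `t` against the truthful buyer. -/
noncomputable def sqDev (a : ℝ) : ℝ≥0∞ :=
  ∫⁻ y, ENNReal.ofReal ((π.feeAt y - a) ^ 2) ∂M.infoLaw π t

theorem indepFun_past_shock : IndepFun (M.past π t) (fun w => w.2 t) (M.law π) := by
  let restrict : (ℕ → Shock d) → Finset.range t → Shock d := fun z i => z i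
  let extend : (Finset.range t → Shock d) → ℕ → Shock d :=
    fun z i => if h : i ∈ Finset.range t then z ⟨i, h⟩ else 0
  have hextend : Measurable extend := by
    refine measurable_pi_iff.2 fun i => ?_
    by_cases h : i ∈ Finset.range t
    · simp only [extend, h, dite_true]; fun_prop
    · simp only [extend, h, dite_false]; fun_prop
  have hshocks : IndepFun restrict (fun z => z t) (Measure.infinitePi fun _ => M.shockLaw) :=
    ((iIndepFun_infinitePi (P := fun _ => M.shockLaw) (X := fun _ s => s)
      fun _ => measurable_id).indepFun_finset (Finset.range t) {t} (by simp)
      fun i => measurable_pi_apply i).comp measurable_id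
        (measurable_pi_apply (⟨t, by simp⟩ : ({t} : Finset ℕ)))
  have hpast : M.past π t
      = (fun p => M.past π t (p.1, extend p.2)) ∘ fun w => (w.1, restrict w.2) :=
    funext fun w => congrArg (w.1, ·) (M.history_congr π _ _ fun i hi => by
      simp [extend, restrict, hi])
  rw [hpast]
  exact (indepFun_prodMk_fst_of_indepFun π.seedLaw (by fun_prop) (by fun_prop) hshocks).comp
    (by fun_prop) measurable_id

theorem map_shock : (M.law π).map (fun w => w.2 t) = M.shockLaw := by
  rw [law, ← Function.comp_def (fun z : ℕ → Shock d => z t) Prod.snd,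
    ← Measure.map_map (by fun_prop) measurable_snd, Measure.map_snd_prod, measure_univ, one_smul,
    Measure.infinitePi_map_eval]

theorem map_info_demandNoise :
    (M.law π).map (fun w => (M.info π t w, (w.2 t).2.2))
      = (M.infoLaw π t).prod M.demandNoise := by
  have hindep : (M.law π).map (fun w => (M.past π t w, w.2 t))
      = (M.pastLaw π t).prod M.shockLaw := by
    rw [(M.indepFun_past_shock π t).map_prod_eq_prod_map_map (by fun_prop) (by fun_prop),
      map_shock, pastLaw]
  have hmap := Measure.map_map (μ := M.law π) (f := fun w => (M.past π t w, w.2 t))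
    (g := fun p : π.Past t × Shock d => (((p.1, p.2.1, M.α₀ + p.2.2.1), p.2.2.2) : π.Info t × ℝ))
    (by fun_prop) (by fun_prop)
  refine hmap.symm.trans ?_
  rw [hindep, shockLaw, infoLaw, interceptLaw]
  refine Measure.ext_of_lintegral _ fun F hF => ?_
  rw [lintegral_map hF (by fun_prop), lintegral_prod _ (by fun_prop),
    lintegral_prod _ (by fun_prop), lintegral_prod _ (by fun_prop)]
  refine lintegral_congr fun p => ?_
  rw [lintegral_prod _ (by fun_prop), lintegral_prod _ (by fun_prop)]
  refine lintegral_congr fun x => ?_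
  rw [lintegral_prod _ (by fun_prop), lintegral_map (by fun_prop) (by fun_prop)]

theorem pastLaw_zero : M.pastLaw π 0 = π.seedLaw.map fun u => (u, Fin.elim0) := by
  have h : M.past π 0 = (fun u => (u, Fin.elim0)) ∘ Prod.fst := rfl
  rw [pastLaw, h, ← Measure.map_map (by fun_prop) measurable_fst, law, Measure.map_fst_prod,
    measure_univ, one_smul]

theorem pastLaw_succ :
    M.pastLaw π (t + 1) = (M.infoLaw π t ⊗ₘ
      noiseKernel (M.measurable_quantityAt π t) M.demandNoise).map (π.extendPast M.α₁) := by
  rw [compProd_noiseKernel, ← map_info_demandNoise,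
    Measure.map_map (by fun_prop) (by fun_prop), Measure.map_map (by fun_prop) (by fun_prop)]
  rfl

variable {M} in
theorem klDiv_pastLaw_succ_le {M' : Market d} (hα₁ : M.α₁ = M'.α₁)
    (hF : M.featureLaw = M'.featureLaw) (hS : M.interceptLaw = M'.interceptLaw)
    (hac : ∀ y : π.Info t, M.demandNoise.map (fun e => M.quantityAt π (y, e))
      ≪ M'.demandNoise.map fun e => M'.quantityAt π (y, e)) :
    klDiv (M.pastLaw π (t + 1)) (M'.pastLaw π (t + 1))
      ≤ klDiv (M.pastLaw π t) (M'.pastLaw π t)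
        + ∫⁻ y, klDiv (M.demandNoise.map fun e => M.quantityAt π (y, e))
          (M'.demandNoise.map fun e => M'.quantityAt π (y, e)) ∂M.infoLaw π t := by
  rw [pastLaw_succ, pastLaw_succ, hα₁]
  refine (klDiv_map_le _ _ (by fun_prop)).trans_eq ?_
  rw [klDiv_compProd_eq_add, klDiv_compProd_right]
  · simp only [noiseKernel_apply]
    rw [infoLaw, infoLaw, ← hF, ← hS, klDiv_prod_left]
  · intro y
    rw [noiseKernel_apply, noiseKernel_apply]
    exact hac y

@[fun_prop]
theorem measurable_optFee {α : Type*} [MeasurableSpace α] {s : α → ℝ} {x : α → Fin d → ℝ}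
    (hs : Measurable s) (hx : Measurable x) : Measurable fun i => M.optFee (s i) (x i) := by
  have := M.measurable_f
  simp only [optFee_eq]
  fun_prop

variable {t}

/-- The revenue loss of round `t` against the truthful buyer, as a function of what the platform
knows and of the demand noise. -/
noncomputable def lossAt (p : π.Info t × ℝ) : ℝ :=
  M.optFee p.1.2.2 p.1.2.1 * M.quantity p.1.2.2 p.1.2.1 (M.optFee p.1.2.2 p.1.2.1) p.2 0
    - π.feeAt p.1 * M.quantityAt π p

theorem measurable_lossAt : Measurable (M.lossAt π : π.Info t × ℝ → ℝ) := by
  unfold lossAt; fun_prop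

variable {M π} {y : π.Info t}

theorem lossAt_eq (hy : y.2.2 ≤ M.f y.2.1) (e : ℝ) :
    M.lossAt π (y, e) = ((π.feeAt y - M.optFee y.2.2 y.2.1) ^ 2
      - (π.feeAt y - M.optFee y.2.2 y.2.1) * e) / (M.α₁ - M.β) := by
  rw [lossAt, optFee_eq, max_eq_right (by linarith), quantityAt, quantity, quantity]
  ring

theorem integrable_lossAt (hy : y.2.2 ≤ M.f y.2.1) :
    Integrable (fun e => M.lossAt π (y, e)) M.demandNoise := by
  simp only [lossAt_eq hy]
  exact ((integrable_const _).sub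
    ((M.demand_memLp.integrable one_le_two).const_mul _)).div_const _

theorem integral_lossAt (hy : y.2.2 ≤ M.f y.2.1) :
    ∫ e, M.lossAt π (y, e) ∂M.demandNoise
      = (π.feeAt y - M.optFee y.2.2 y.2.1) ^ 2 / (M.α₁ - M.β) := by
  simp only [lossAt_eq hy]
  rw [integral_div, integral_sub (integrable_const _)
    ((M.demand_memLp.integrable one_le_two).const_mul _), integral_const_mul, M.demand_mean]
  simp

theorem neg_lossAt_le (hy : y.2.2 ≤ M.f y.2.1) (e : ℝ) :
    -M.lossAt π (y, e) ≤ e ^ 2 / (4 * (M.α₁ - M.β)) := by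
  have hm := M.slope_pos
  rw [lossAt_eq hy, ← neg_div, div_le_div_iff₀ hm (by positivity)]
  generalize π.feeAt y - M.optFee y.2.2 y.2.1 = u
  linarith [mul_nonneg hm.le (sq_nonneg (2 * u - e))]

theorem extExpect_roundLoss (hle : ∀ᵐ y ∂M.infoLaw π t, y.2.2 ≤ M.f y.2.1) :
    extExpect (M.law π) (M.roundLoss π (truthful d) t)
      = ((∫⁻ y, ENNReal.ofReal ((π.feeAt y - M.optFee y.2.2 y.2.1) ^ 2 / (M.α₁ - M.β))
          ∂M.infoLaw π t : ℝ≥0∞) : EReal) := by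
  have hloss : M.roundLoss π (truthful d) t
      = M.lossAt π ∘ fun w => (M.info π t w, (w.2 t).2.2) := rfl
  rw [hloss, ← extExpect_map _ (by fun_prop) (M.measurable_lossAt π), map_info_demandNoise,
    extExpect_prod _ _ (M.measurable_lossAt π)]
  · congr 1
    exact lintegral_congr_ae (hle.mono fun y hy => by simp only [integral_lossAt hy])
  · exact hle.mono fun y hy => integrable_lossAt hy
  · filter_upwards [hle] with y hy
    have := M.slope_pos
    rw [integral_lossAt hy]
    positivity
  · have hbound : ∀ᵐ y ∂M.infoLaw π t, ∫⁻ e, ENNReal.ofReal (-M.lossAt π (y, e)) ∂M.demandNoise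
        ≤ ∫⁻ e, ENNReal.ofReal (e ^ 2 / (4 * (M.α₁ - M.β))) ∂M.demandNoise :=
      hle.mono fun y hy => lintegral_mono fun e => ENNReal.ofReal_le_ofReal (neg_lossAt_le hy e)
    refine ((lintegral_mono_ae hbound).trans_lt ?_).ne
    simpa using (M.demand_memLp.integrable_sq.div_const _).lintegral_lt_top

end Market

/-- The parameters of a market with supply curve `α₀ + α₁ Q` and demand curve `r + β Q + ε_D`,
where `ε_D` is Gaussian with variance `v`. -/
structure GaussianCurves where
  α₀ : ℝ
  α₁ : ℝ
  β : ℝ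
  r : ℝ
  v : ℝ≥0
  α₁_nonneg : 0 ≤ α₁
  β_neg : β < 0
  α₀_lt_r : α₀ < r
  v_ne_zero : v ≠ 0

namespace GaussianCurves

variable (P : GaussianCurves)

/-- The difference of the slopes of supply and demand. -/
def slope : ℝ := P.α₁ - P.β

/-- The fee of the clairvoyant platform. -/
noncomputable def bestFee : ℝ := (P.r - P.α₀) / 2

/-- The variance of the traded quantity. -/
noncomputable def quantityVar : ℝ≥0 := P.v / (P.slope ^ 2).toNNReal

theorem coe_quantityVar : (P.quantityVar : ℝ) = P.v / P.slope ^ 2 := by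
  rw [quantityVar, NNReal.coe_div, Real.coe_toNNReal _ (sq_nonneg _)]

theorem slope_pos : 0 < P.slope := sub_pos.2 (P.β_neg.trans_le P.α₁_nonneg)

theorem quantityVar_ne_zero : P.quantityVar ≠ 0 :=
  div_ne_zero P.v_ne_zero (Real.toNNReal_pos.2 (pow_pos P.slope_pos 2)).ne'

theorem bestFee_pos : 0 < P.bestFee := half_pos (sub_pos.2 P.α₀_lt_r)

/-- The curves after a rotation of the demand curve about the expected trade at the fee `bestFee`.
The noise is rescaled so that `quantityVar` is kept. -/
noncomputable def rotate (θ : ℝ≥0) : GaussianCurves where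
  α₀ := P.α₀
  α₁ := P.α₁
  β := P.β - P.slope * θ
  r := P.r + P.bestFee * θ
  v := P.v * (1 + θ) ^ 2
  α₁_nonneg := P.α₁_nonneg
  β_neg := by linarith [P.β_neg, mul_nonneg P.slope_pos.le θ.coe_nonneg]
  α₀_lt_r := by linarith [P.α₀_lt_r, mul_nonneg P.bestFee_pos.le θ.coe_nonneg]
  v_ne_zero := mul_ne_zero P.v_ne_zero (by positivity)

theorem rotate_zero : P.rotate 0 = P := by
  cases P
  simp [rotate]

theorem slope_rotate (θ : ℝ≥0) : (P.rotate θ).slope = P.slope * (1 + θ) := by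
  simp only [slope, rotate]
  ring

theorem bestFee_rotate (θ : ℝ≥0) :
    (P.rotate θ).bestFee = P.bestFee + P.bestFee * θ / 2 := by
  simp only [bestFee, rotate]
  ring

theorem quantityVar_rotate (θ : ℝ≥0) : (P.rotate θ).quantityVar = P.quantityVar := by
  ext
  rw [coe_quantityVar, coe_quantityVar, slope_rotate]
  simp only [rotate, NNReal.coe_mul, NNReal.coe_pow, NNReal.coe_add, NNReal.coe_one, mul_pow]
  exact mul_div_mul_right _ _ (by positivity)

/-- The market with the given curves and feature law, whose supply has no noise. -/
noncomputable def market {d : ℕ} (PX : Measure (Fin d → ℝ)) [IsProbabilityMeasure PX]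
    (hPX : ∀ᵐ x ∂PX, x ∈ Set.Icc (0 : Fin d → ℝ) 1) : Market d where
  α₀ := P.α₀
  α₁ := P.α₁
  β := P.β
  f _ := P.r
  featureLaw := PX
  supplyNoise := Measure.dirac 0
  demandNoise := gaussianReal 0 P.v
  α₁_nonneg := P.α₁_nonneg
  β_neg := P.β_neg
  measurable_f := measurable_const
  isProb_feature := inferInstance
  isProb_supply := inferInstance
  isProb_demand := inferInstance
  feature_mem := hPX
  supply_mean := by simp
  supply_subGaussian := ⟨0, ⟨fun t => integrable_dirac (by simp), fun t => by simp [mgf]⟩⟩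
  demand_memLp := memLp_id_gaussianReal 2
  demand_mean := integral_id_gaussianReal
  demand_logConcave := stronglyLogConcave_gaussianReal P.v_ne_zero

variable {d : ℕ} {PX : Measure (Fin d → ℝ)} [IsProbabilityMeasure PX]
  {hPX : ∀ᵐ x ∂PX, x ∈ Set.Icc (0 : Fin d → ℝ) 1} (π : Policy d) {t : ℕ}

theorem ae_infoLaw_market : ∀ᵐ y ∂(P.market PX hPX).infoLaw π t, y.2.2 = P.α₀ := by
  have h : (P.market PX hPX).interceptLaw = Measure.dirac P.α₀ := by
    simp [Market.interceptLaw, market, Measure.map_dirac]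
  rw [Market.infoLaw, h]
  have hsnd : Measure.QuasiMeasurePreserving (fun y : π.Info t => y.2.2)
      (((P.market PX hPX).pastLaw π t).prod (PX.prod (Measure.dirac P.α₀)))
      (Measure.dirac P.α₀) :=
    Measure.quasiMeasurePreserving_snd.comp Measure.quasiMeasurePreserving_snd
  exact hsnd.ae (p := (· = P.α₀)) (by simp [ae_dirac_eq])

theorem regret_market (T : ℕ) : (P.market PX hPX).regret π (truthful d) T
    = (((∑ t ∈ Finset.range T, (P.market PX hPX).sqDev π t P.bestFee)
      / ENNReal.ofReal P.slope : ℝ≥0∞) : EReal) := by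
  have hround (t : ℕ) : extExpect ((P.market PX hPX).law π)
      ((P.market PX hPX).roundLoss π (truthful d) t)
      = (((P.market PX hPX).sqDev π t P.bestFee / ENNReal.ofReal P.slope : ℝ≥0∞) : EReal) := by
    rw [Market.extExpect_roundLoss, Market.sqDev, ENNReal.div_eq_inv_mul,
      ← lintegral_const_mul _ (by fun_prop)]
    · congr 1
      refine lintegral_congr_ae ((P.ae_infoLaw_market π).mono fun y hy => ?_)
      have hopt : (P.market PX hPX).optFee y.2.2 y.2.1 = P.bestFee := by
        rw [Market.optFee_eq, hy]
        exact max_eq_right P.bestFee_pos.le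
      simp only [hopt]
      rw [← ENNReal.div_eq_inv_mul, ← ENNReal.ofReal_div_of_pos P.slope_pos]
      rfl
    · exact (P.ae_infoLaw_market π).mono fun y hy => hy.trans_le P.α₀_lt_r.le
  simp only [Market.regret, hround, ENNReal.div_eq_inv_mul, Finset.mul_sum]
  exact (map_sum (⟨⟨(↑), EReal.coe_ennreal_zero⟩, EReal.coe_ennreal_add⟩ : ℝ≥0∞ →+ EReal) _ _).symm

theorem map_quantityAt_market (y : π.Info t) :
    (P.market PX hPX).demandNoise.map (fun e => (P.market PX hPX).quantityAt π (y, e))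
      = gaussianReal ((P.r - y.2.2 - π.feeAt y) / P.slope) P.quantityVar := by
  have h : (fun e => (P.market PX hPX).quantityAt π (y, e))
      = (fun e => (P.r - y.2.2 - π.feeAt y) / P.slope + e) ∘ (fun e => e / P.slope) := by
    funext e
    simp only [Market.quantityAt, Market.quantity, market, slope, Function.comp]
    ring
  rw [h, ← Measure.map_map (by fun_prop) (by fun_prop)]
  simp only [market]
  rw [gaussianReal_map_div_const, gaussianReal_map_const_add]
  congr 1
  · simp
  · ext
    simp only [coe_quantityVar, NNReal.coe_div, NNReal.coe_mk]

theorem klDiv_map_quantityAt_rotate_le (θ : ℝ≥0) {y : π.Info t} (hy : y.2.2 = P.α₀) :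
    klDiv ((P.market PX hPX).demandNoise.map fun e => (P.market PX hPX).quantityAt π (y, e))
      (((P.rotate θ).market PX hPX).demandNoise.map fun e =>
        ((P.rotate θ).market PX hPX).quantityAt π (y, e))
      ≤ ENNReal.ofReal (θ ^ 2 / (2 * P.v)) * ENNReal.ofReal ((π.feeAt y - P.bestFee) ^ 2) := by
  have hm := P.slope_pos
  have hmean : (P.r - y.2.2 - π.feeAt y) / P.slope
      - ((P.rotate θ).r - y.2.2 - π.feeAt y) / (P.rotate θ).slope
      = -(θ * (π.feeAt y - P.bestFee) / (P.slope * (1 + θ))) := by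
    rw [slope_rotate, hy]
    simp only [rotate, bestFee]
    field_simp
    ring
  rw [map_quantityAt_market, map_quantityAt_market, quantityVar_rotate,
    klDiv_gaussianReal _ _ P.quantityVar_ne_zero, hmean, coe_quantityVar,
    ← ENNReal.ofReal_mul (by positivity)]
  refine ENNReal.ofReal_le_ofReal ?_
  have hv : (0 : ℝ) < P.v := NNReal.coe_pos.2 (pos_iff_ne_zero.2 P.v_ne_zero)
  calc (-(θ * (π.feeAt y - P.bestFee) / (P.slope * (1 + θ)))) ^ 2 / (2 * (P.v / P.slope ^ 2))
      = θ ^ 2 / (2 * P.v) * (π.feeAt y - P.bestFee) ^ 2 / (1 + θ) ^ 2 := by field_simp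
    _ ≤ θ ^ 2 / (2 * P.v) * (π.feeAt y - P.bestFee) ^ 2 :=
      div_le_self (by positivity) (one_le_pow₀ (by simp))

variable (t)

theorem klDiv_pastLaw_rotate_le (θ : ℝ≥0) :
    klDiv ((P.market PX hPX).pastLaw π t) (((P.rotate θ).market PX hPX).pastLaw π t)
      ≤ ENNReal.ofReal (θ ^ 2 / (2 * P.v))
        * ∑ s ∈ Finset.range t, (P.market PX hPX).sqDev π s P.bestFee := by
  induction t with
  | zero => simp [Market.pastLaw_zero]
  | succ t ih =>
    rw [Finset.sum_range_succ, mul_add]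
    refine (Market.klDiv_pastLaw_succ_le (M := P.market PX hPX)
      (M' := (P.rotate θ).market PX hPX) π t rfl rfl rfl fun y => ?_).trans (add_le_add ih ?_)
    · rw [map_quantityAt_market, map_quantityAt_market, quantityVar_rotate]
      exact (gaussianReal_absolutelyContinuous _ P.quantityVar_ne_zero).trans
        (gaussianReal_absolutelyContinuous' _ P.quantityVar_ne_zero)
    · rw [Market.sqDev, ← lintegral_const_mul _ (by fun_prop)]
      exact lintegral_mono_ae ((P.ae_infoLaw_market π).mono fun y hy =>
        P.klDiv_map_quantityAt_rotate_le π θ hy)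

theorem le_sqDev_add_sqDev_rotate (θ : ℝ≥0) :
    ENNReal.ofReal ((P.bestFee * θ) ^ 2 / 16)
      ≤ (P.market PX hPX).sqDev π t P.bestFee
        + ((P.rotate θ).market PX hPX).sqDev π t (P.rotate θ).bestFee
        + ENNReal.ofReal ((P.bestFee * θ ^ 2) ^ 2 / (16 * P.v))
          * ∑ s ∈ Finset.range t, (P.market PX hPX).sqDev π s P.bestFee := by
  have hpoint (y : π.Info t) : ENNReal.ofReal ((P.bestFee * θ) ^ 2 / 8)
      ≤ ENNReal.ofReal ((π.feeAt y - P.bestFee) ^ 2)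
        + ENNReal.ofReal ((π.feeAt y - (P.rotate θ).bestFee) ^ 2) := by
    rw [← ENNReal.ofReal_add (sq_nonneg _) (sq_nonneg _), bestFee_rotate]
    exact ENNReal.ofReal_le_ofReal
      (by linarith [sq_nonneg (2 * (π.feeAt y - P.bestFee) - P.bestFee * θ / 2)])
  have hkl : klDiv ((P.market PX hPX).infoLaw π t) (((P.rotate θ).market PX hPX).infoLaw π t)
      ≤ ENNReal.ofReal (θ ^ 2 / (2 * P.v))
        * ∑ s ∈ Finset.range t, (P.market PX hPX).sqDev π s P.bestFee :=
    (klDiv_prod_left _ _ _).trans_le (P.klDiv_pastLaw_rotate_le π t θ)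
  calc ENNReal.ofReal ((P.bestFee * θ) ^ 2 / 16)
      = ENNReal.ofReal ((P.bestFee * θ) ^ 2 / 8) / 2 := by
        rw [← ENNReal.ofReal_ofNat 2, ← ENNReal.ofReal_div_of_pos two_pos]
        congr 1
        ring
    _ ≤ _ := half_le_lintegral_add_lintegral_add_klDiv _ _ (by fun_prop) hpoint
    _ ≤ _ := add_le_add_right (mul_le_mul_right hkl _) _
    _ = _ := by
      rw [← mul_assoc, ← ENNReal.ofReal_mul (by positivity)]
      congr 3
      ring

theorem le_sum_sqDev_add_sum_sqDev_rotate (θ : ℝ≥0) (T : ℕ) :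
    ENNReal.ofReal (T * (P.bestFee * θ) ^ 2 / 16)
      ≤ ENNReal.ofReal (1 + T * (P.bestFee * θ ^ 2) ^ 2 / (16 * P.v))
          * ∑ t ∈ Finset.range T, (P.market PX hPX).sqDev π t P.bestFee
        + ∑ t ∈ Finset.range T, ((P.rotate θ).market PX hPX).sqDev π t (P.rotate θ).bestFee := by
  set S := ∑ t ∈ Finset.range T, (P.market PX hPX).sqDev π t P.bestFee
  have hround : ∀ t ∈ Finset.range T, ENNReal.ofReal ((P.bestFee * θ) ^ 2 / 16)
      ≤ (P.market PX hPX).sqDev π t P.bestFee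
        + ((P.rotate θ).market PX hPX).sqDev π t (P.rotate θ).bestFee
        + ENNReal.ofReal ((P.bestFee * θ ^ 2) ^ 2 / (16 * P.v)) * S := fun t ht => by
    refine (P.le_sqDev_add_sqDev_rotate (hPX := hPX) π t θ).trans ?_
    gcongr
    exact Finset.sum_le_sum_of_subset (Finset.range_mono (Finset.mem_range.1 ht).le)
  have hsum := Finset.sum_le_sum hround
  rw [Finset.sum_const, Finset.sum_add_distrib, Finset.sum_add_distrib, Finset.sum_const,
    Finset.card_range, nsmul_eq_mul, nsmul_eq_mul] at hsum
  have hT (x : ℝ) (y : ℝ) : (T : ℝ≥0∞) * ENNReal.ofReal (x / y) = ENNReal.ofReal (T * x / y) := by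
    rw [mul_div_assoc, ENNReal.ofReal_mul T.cast_nonneg, ENNReal.ofReal_natCast]
  rw [hT, ← mul_assoc, hT] at hsum
  refine hsum.trans_eq ?_
  rw [ENNReal.ofReal_add one_pos.le (by positivity), ENNReal.ofReal_one]
  ring

theorem sum_sqDev_lt_of_regret_lt {T : ℕ} {y : ℝ}
    (h : (P.market PX hPX).regret π (truthful d) T < (y : EReal)) :
    ∑ t ∈ Finset.range T, (P.market PX hPX).sqDev π t P.bestFee
      < ENNReal.ofReal (y * P.slope) := by
  have hy : 0 < y := by
    rw [regret_market] at h
    exact_mod_cast (EReal.coe_ennreal_nonneg _).trans_lt h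
  rw [regret_market, ← max_eq_left hy.le, ← EReal.coe_ennreal_ofReal,
    EReal.coe_ennreal_lt_coe_ennreal_iff, ENNReal.div_lt_iff] at h
  · rwa [ENNReal.ofReal_mul hy.le]
  · exact .inl (ENNReal.ofReal_pos.2 P.slope_pos).ne'
  · exact .inl ENNReal.ofReal_ne_top

theorem lt_of_regret_lt_of_regret_rotate_lt {θ : ℝ≥0} {T : ℕ} {y : ℝ}
    (h : (P.market PX hPX).regret π (truthful d) T < (y : EReal))
    (hθ : ((P.rotate θ).market PX hPX).regret π (truthful d) T < (y : EReal)) :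
    T * (P.bestFee * θ) ^ 2 / 16
      < (2 + θ + T * (P.bestFee * θ ^ 2) ^ 2 / (16 * P.v)) * (y * P.slope) := by
  have hS := P.sum_sqDev_lt_of_regret_lt π h
  have hSθ := (P.rotate θ).sum_sqDev_lt_of_regret_lt π hθ
  have hy := ENNReal.ofReal_pos.1 (bot_le.trans_lt hS)
  have hm := P.slope_pos
  have hy' : 0 < y := pos_of_mul_pos_left hy hm.le
  have hlt := (P.le_sum_sqDev_add_sum_sqDev_rotate π θ T).trans_lt
    (ENNReal.add_lt_add_of_le_of_lt (by finiteness) (mul_le_mul_right hS.le _) hSθ)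
  rw [slope_rotate, ← ENNReal.ofReal_mul (by positivity), ← mul_assoc,
    ← ENNReal.ofReal_add (by positivity) (by positivity), ENNReal.ofReal_lt_ofReal_iff_of_nonneg
      (by positivity)] at hlt
  linarith

theorem exists_sqrt_le_regret_rotate {η : ℝ≥0} (hη : 0 < η) :
    ∃ c : ℝ, 0 < c ∧ ∀ (d : ℕ) (PX : Measure (Fin d → ℝ)) [IsProbabilityMeasure PX]
      (hPX : ∀ᵐ x ∂PX, x ∈ Set.Icc (0 : Fin d → ℝ) 1) (T : ℕ), 1 ≤ T → ∀ π : Policy d,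
        ∃ θ ≤ η, ((c * √T : ℝ) : EReal)
          ≤ ((P.rotate θ).market PX hPX).regret π (truthful d) T := by
  have ha := P.bestFee_pos
  have hm := P.slope_pos
  have hv : (0 : ℝ) < P.v := NNReal.coe_pos.2 (pos_iff_ne_zero.2 P.v_ne_zero)
  let K := 2 + η + (P.bestFee * η ^ 2) ^ 2 / (16 * P.v)
  have hK : 0 < K := by positivity
  refine ⟨(P.bestFee * η) ^ 2 / (16 * (K * P.slope)), by positivity, fun d PX _ hPX T hT π => ?_⟩
  obtain ⟨q, hq1, hq⟩ : ∃ q : ℝ≥0, 1 ≤ q ∧ (q : ℝ) ^ 2 = √T :=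
    ⟨NNReal.sqrt (NNReal.sqrt T), by simpa using hT, by simp⟩
  have hT4 : (T : ℝ) = q ^ 4 := by rw [← Real.sq_sqrt T.cast_nonneg, ← hq]; ring
  have : (q : ℝ) ≠ 0 := (NNReal.coe_pos.2 (one_pos.trans_le hq1)).ne'
  have hθη : η / q ≤ η := div_le_self zero_le hq1
  have hquartic : T * (P.bestFee * (η / q : ℝ≥0) ^ 2) ^ 2 = (P.bestFee * η ^ 2) ^ 2 := by
    rw [hT4, NNReal.coe_div]
    field_simp
  by_contra! hlt
  have hlt₀ := hlt 0 hη.le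
  rw [rotate_zero] at hlt₀
  refine (P.lt_of_regret_lt_of_regret_rotate_lt π hlt₀ (hlt (η / q) hθη)).not_ge ?_
  calc (2 + ↑(η / q) + T * (P.bestFee * (η / q : ℝ≥0) ^ 2) ^ 2 / (16 * P.v))
        * ((P.bestFee * η) ^ 2 / (16 * (K * P.slope)) * √T * P.slope)
      ≤ K * ((P.bestFee * η) ^ 2 / (16 * (K * P.slope)) * √T * P.slope) := by
        rw [hquartic]
        gcongr
        exact add_le_add_left (add_le_add_right (NNReal.coe_le_coe.2 hθη) _) _
    _ = T * (P.bestFee * (η / q : ℝ≥0)) ^ 2 / 16 := by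
        rw [← hq, hT4, NNReal.coe_div]
        field_simp

theorem exists_forall_le_rotate_mem {B βlo βhi vlo vhi : ℝ} (hr : |P.r| < B)
    (hβ : P.β ∈ Set.Ioo βlo βhi) (hv : (P.v : ℝ) ∈ Set.Ioo vlo vhi) :
    ∃ η : ℝ≥0, 0 < η ∧ ∀ θ ≤ η, |(P.rotate θ).r| < B ∧ (P.rotate θ).β ∈ Set.Ioo βlo βhi ∧
      ((P.rotate θ).v : ℝ) ∈ Set.Ioo vlo vhi := by
  have hr_cont : Continuous fun θ => |(P.rotate θ).r| := by unfold rotate; fun_prop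
  have hβ_cont : Continuous fun θ => (P.rotate θ).β := by unfold rotate; fun_prop
  have hv_cont : Continuous fun θ => ((P.rotate θ).v : ℝ) := by unfold rotate; fun_prop
  have hopen : IsOpen {θ | |(P.rotate θ).r| < B ∧ (P.rotate θ).β ∈ Set.Ioo βlo βhi ∧
      ((P.rotate θ).v : ℝ) ∈ Set.Ioo vlo vhi} :=
    (isOpen_lt hr_cont continuous_const).inter
      ((isOpen_Ioo.preimage hβ_cont).inter (isOpen_Ioo.preimage hv_cont))
  obtain ⟨ε, hε, h⟩ := NNReal.nhds_zero_basis.mem_iff.1 (hopen.mem_nhds (x := 0)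
    (by simpa only [Set.mem_ofPred_eq, rotate_zero] using ⟨hr, hβ, hv⟩))
  exact ⟨ε / 2, half_pos hε, fun θ hθ => h (hθ.trans_lt (half_lt_self hε))⟩

end GaussianCurves

end ServiceFee

theorem theorem3
    (α₀ α₁ B βlo βhi vlo vhi : ℝ)
    (hα₁ : 0 ≤ α₁) (hB : 0 < B) (hα₀ : α₀ < B)
    (hβ : βlo < βhi) (hβhi : βhi < 0) (hvlo : 0 ≤ vlo) (hv : vlo < vhi) :
    ∃ c : ℝ, 0 < c ∧
      ∀ (d : ℕ) (F : Set ((Fin d → ℝ) → ℝ)) (PX : MeasureTheory.Measure (Fin d → ℝ)),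
        (∀ r : ℝ, |r| ≤ B → (fun _ => r) ∈ F) →
        MeasureTheory.IsProbabilityMeasure PX →
        (∀ᵐ x ∂PX, x ∈ Set.Icc (0 : Fin d → ℝ) 1) →
        ∀ (T : ℕ), 1 ≤ T → ∀ π : ServiceFee.Policy d,
          ∃ M : ServiceFee.Market d,
            M.α₀ = α₀ ∧ M.α₁ = α₁ ∧ M.featureLaw = PX ∧
            ProbabilityTheory.variance (fun e : ℝ => e) M.supplyNoise = 0 ∧
            M.f ∈ F ∧ (∀ x, |M.f x| ≤ B) ∧
            M.β ∈ Set.Icc βlo βhi ∧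
            ProbabilityTheory.variance (fun e : ℝ => e) M.demandNoise ∈ Set.Icc vlo vhi ∧
            ∀ b : ServiceFee.Buyer d, M.IsMyopic b →
              ((c * Real.sqrt T : ℝ) : EReal) ≤ M.regret π b T := by
  obtain ⟨β, hβ₁, hβ₂⟩ := exists_between hβ
  obtain ⟨v, hv₁, hv₂⟩ := exists_between hv
  obtain ⟨r, hr, hrB⟩ := exists_between (max_lt hα₀ (neg_lt_self hB))
  rw [max_lt_iff] at hr
  have hv₀ : 0 < v := hvlo.trans_lt hv₁
  lift v to NNReal using hv₀.le
  let P : ServiceFee.GaussianCurves :=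
    ⟨α₀, α₁, β, r, v, hα₁, hβ₂.trans hβhi, hr.1, (NNReal.coe_pos.1 hv₀).ne'⟩
  obtain ⟨η, hη, hη_mem⟩ :=
    P.exists_forall_le_rotate_mem (abs_lt.2 ⟨hr.2, hrB⟩) ⟨hβ₁, hβ₂⟩ ⟨hv₁, hv₂⟩
  obtain ⟨c, hc, hc_le⟩ := P.exists_sqrt_le_regret_rotate hη
  refine ⟨c, hc, fun d F PX hF _ hPX T hT π => ?_⟩
  obtain ⟨θ, hθ, hregret⟩ := hc_le d PX hPX T hT π
  obtain ⟨hrθ, hβθ, hvθ⟩ := hη_mem θ hθ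
  refine ⟨(P.rotate θ).market PX hPX, rfl, rfl, rfl, variance_dirac _, hF _ hrθ.le,
    fun _ => hrθ.le, Set.Ioo_subset_Icc_self hβθ, ?_, fun b hb => ?_⟩
  · exact (variance_fun_id_gaussianReal (μ := 0)).symm ▸ Set.Ioo_subset_Icc_self hvθ
  · rwa [ServiceFee.Market.eq_truthful_of_isMyopic _ hb]
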